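/- Let $g:\mathbb{R}^d\to[0,\infty)$ be continuously differentiable with $L$-Lipschitz gradient, let $\alpha_0,S_0>0$ and $\sigma_0,\sigma_1\ge 0$, and let $\theta_1\in\mathbb{R}^d$ be any (deterministic) initial point. Let $\xi_1,\xi_2,\dots$ be independent random variables, let $\nabla g(\theta,\xi)\in\mathbb{R}^d$ be a stochastic gradient, measurable in $(\theta,\xi)$, and let AdaGrad-Norm be the recursion $$S_n=S_{n-1}+\|\nabla g(\theta_n,\xi_n)\|^2,\qquad \theta_{n+1}=\theta_n-\frac{\alpha_0}{\sqrt{S_n}}\,\nabla g(\theta_n,\xi_n)\qquad(n\ge 1).$$ Let $\mathscr F_n=\sigma(\xi_1,\dots,\xi_n)$, with $\mathscr F_0$ trivial. Suppose that, for all $n\ge 1$, almost surely, $$\mathbb{E}[\nabla g(\theta_n,\xi_n)\mid\mathscr F_{n-1}]=\nabla g(\theta_n),\qquad \mathbb{E}\big[\|\nabla g(\theta_n,\xi_n)\|^2\mid\mathscr F_{n-1}\big]\le\sigma_0\|\nabla g(\theta_n)\|^2+\sigma_1 ,$$ where $\nabla g(\theta_n,\xi_n)$ is square-integrable. Then $\mathbb{E}[S_T]=\mathcal{O}(T)$: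 there is a constant $C$, depending only on $L,\sigma_0,\sigma_1,\alpha_0,S_0$ and $g(\theta_1)$, such that $\mathbb{E}[S_T]<\infty$ and $\mathbb{E}[S_T]\le C\,T$ for all integers $T\ge 1$. -/

import Mathlib

open MeasureTheory ProbabilityTheory
open scoped NNReal

noncomputable section

/-- The joint state `(θ_{n+1}, S_n)` of AdaGrad-Norm with stochastic gradient oracle
`G θ z` (written `∇g(θ, z)` on paper), along a realised noise sequence `z 1, z 2, …`:
`S_{n+1} = S_n + ‖G θ_{n+1} z_{n+1}‖²`,
`θ_{n+2} = θ_{n+1} - (α₀ / √S_{n+1}) • G θ_{n+1} z_{n+1}`.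
The entry `z 0` is not used. -/
def adaGradNormState {d : ℕ} {Ξ : Type*}
    (G : EuclideanSpace ℝ (Fin d) → Ξ → EuclideanSpace ℝ (Fin d))
    (α₀ S₀ : ℝ) (θ₁ : EuclideanSpace ℝ (Fin d)) (z : ℕ → Ξ) :
    ℕ → EuclideanSpace ℝ (Fin d) × ℝ
  | 0 => (θ₁, S₀)
  | n + 1 =>
    let θ := (adaGradNormState G α₀ S₀ θ₁ z n).1
    let S := (adaGradNormState G α₀ S₀ θ₁ z n).2 + ‖G θ (z (n + 1))‖ ^ 2
    (θ - (α₀ / Real.sqrt S) • G θ (z (n + 1)), S)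

/-- The iterate `θ_n`, `n ≥ 1` (the value at `n = 0` is a dummy, equal to `θ₁`). -/
def adaGradNormIterate {d : ℕ} {Ξ : Type*}
    (G : EuclideanSpace ℝ (Fin d) → Ξ → EuclideanSpace ℝ (Fin d))
    (α₀ S₀ : ℝ) (θ₁ : EuclideanSpace ℝ (Fin d)) (z : ℕ → Ξ) (n : ℕ) :
    EuclideanSpace ℝ (Fin d) :=
  (adaGradNormState G α₀ S₀ θ₁ z (n - 1)).1

/-- The accumulator `S_n`, `n ≥ 0`. -/
def adaGradNormAccum {d : ℕ} {Ξ : Type*}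
    (G : EuclideanSpace ℝ (Fin d) → Ξ → EuclideanSpace ℝ (Fin d))
    (α₀ S₀ : ℝ) (θ₁ : EuclideanSpace ℝ (Fin d)) (z : ℕ → Ξ) (n : ℕ) : ℝ :=
  (adaGradNormState G α₀ S₀ θ₁ z n).2

theorem adaGradNormIterate_one {d : ℕ} {Ξ : Type*}
    (G : EuclideanSpace ℝ (Fin d) → Ξ → EuclideanSpace ℝ (Fin d))
    (α₀ S₀ : ℝ) (θ₁ : EuclideanSpace ℝ (Fin d)) (z : ℕ → Ξ) :
    adaGradNormIterate G α₀ S₀ θ₁ z 1 = θ₁ := rfl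

theorem adaGradNormAccum_zero {d : ℕ} {Ξ : Type*}
    (G : EuclideanSpace ℝ (Fin d) → Ξ → EuclideanSpace ℝ (Fin d))
    (α₀ S₀ : ℝ) (θ₁ : EuclideanSpace ℝ (Fin d)) (z : ℕ → Ξ) :
    adaGradNormAccum G α₀ S₀ θ₁ z 0 = S₀ := rfl

theorem adaGradNormAccum_succ {d : ℕ} {Ξ : Type*}
    (G : EuclideanSpace ℝ (Fin d) → Ξ → EuclideanSpace ℝ (Fin d))
    (α₀ S₀ : ℝ) (θ₁ : EuclideanSpace ℝ (Fin d)) (z : ℕ → Ξ) (n : ℕ) :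
    adaGradNormAccum G α₀ S₀ θ₁ z (n + 1) = adaGradNormAccum G α₀ S₀ θ₁ z n
      + ‖G (adaGradNormIterate G α₀ S₀ θ₁ z (n + 1)) (z (n + 1))‖ ^ 2 := rfl

theorem adaGradNormIterate_succ {d : ℕ} {Ξ : Type*}
    (G : EuclideanSpace ℝ (Fin d) → Ξ → EuclideanSpace ℝ (Fin d))
    (α₀ S₀ : ℝ) (θ₁ : EuclideanSpace ℝ (Fin d)) (z : ℕ → Ξ) (n : ℕ) :
    adaGradNormIterate G α₀ S₀ θ₁ z (n + 2) = adaGradNormIterate G α₀ S₀ θ₁ z (n + 1)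
      - (α₀ / Real.sqrt (adaGradNormAccum G α₀ S₀ θ₁ z (n + 1)))
        • G (adaGradNormIterate G α₀ S₀ θ₁ z (n + 1)) (z (n + 1)) := rfl

/-- The σ-algebra `ℱ_n = σ(ξ_1, …, ξ_n)`; `ℱ_0` is trivial. (The initial point is
deterministic, so it contributes nothing.) -/
abbrev noiseSigma {Ω Ξ : Type*} [MeasurableSpace Ξ] (ξ : ℕ → Ω → Ξ) (n : ℕ) :
    MeasurableSpace Ω :=
  ⨆ k ∈ Finset.Icc 1 n, MeasurableSpace.comap (ξ k) inferInstance

/-- Smoothness: `g` is continuously differentiable and non-negative, and its gradient is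
`L`-Lipschitz. -/
structure SmoothObjective {d : ℕ} (g : EuclideanSpace ℝ (Fin d) → ℝ) (L : ℝ≥0) : Prop where
  contDiff : ContDiff ℝ 1 g
  nonneg : ∀ θ, 0 ≤ g θ
  lipschitz : LipschitzWith L (gradient g)

/-- The stochastic first-order oracle along the AdaGrad-Norm trajectory: the noise variables
are independent, and for all `n ≥ 1` (below `n = k + 1`) the stochastic gradient at `θ_n`
is conditionally unbiased given `ℱ_{n-1}` and has affine conditional second moment. The
field `integrable_sq` says that this conditional second moment is the genuine one and not
the default value of `condExp` on a non-integrable function. -/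
structure AffineNoiseOracle {d : ℕ} {Ω Ξ : Type*} [MeasurableSpace Ω] [MeasurableSpace Ξ]
    (μ : Measure Ω) (g : EuclideanSpace ℝ (Fin d) → ℝ)
    (G : EuclideanSpace ℝ (Fin d) → Ξ → EuclideanSpace ℝ (Fin d)) (ξ : ℕ → Ω → Ξ)
    (α₀ S₀ : ℝ) (θ₁ : EuclideanSpace ℝ (Fin d)) (σ₀ σ₁ : ℝ) : Prop where
  measurable_oracle : Measurable (Function.uncurry G)
  measurable_noise : ∀ n, Measurable (ξ n)
  indep : iIndepFun (fun k : ℕ => ξ (k + 1)) μ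
  integrable_sq : ∀ k : ℕ, Integrable
    (fun ω => ‖G (adaGradNormIterate G α₀ S₀ θ₁ (fun i => ξ i ω) (k + 1)) (ξ (k + 1) ω)‖ ^ 2) μ
  unbiased : ∀ k : ℕ,
    μ[fun ω => G (adaGradNormIterate G α₀ S₀ θ₁ (fun i => ξ i ω) (k + 1)) (ξ (k + 1) ω)
        | noiseSigma ξ k]
      =ᵐ[μ] fun ω => gradient g (adaGradNormIterate G α₀ S₀ θ₁ (fun i => ξ i ω) (k + 1))
  affine_variance : ∀ k : ℕ,
    μ[fun ω => ‖G (adaGradNormIterate G α₀ S₀ θ₁ (fun i => ξ i ω) (k + 1)) (ξ (k + 1) ω)‖ ^ 2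
        | noiseSigma ξ k]
      ≤ᵐ[μ] fun ω =>
        σ₀ * ‖gradient g (adaGradNormIterate G α₀ S₀ θ₁ (fun i => ξ i ω) (k + 1))‖ ^ 2 + σ₁

end

/-! The potential `(g² + 2K) / √S` decreases in mean. With `M = L + 1`, Taylor expansion of `g²`
along a step leaves a descent term plus errors of order `(g² + K) ‖X‖² / S'`, where `X` is the
stochastic gradient and `S' = S + ‖X‖²`. The growth of `√S` in the denominator pays for these
errors. The random step size is compared with the predictable `1 / √(S + e²)`, where `e² = σ₀‖∇g‖² +
σ₁ + 1` dominates the conditional second moment of `X`. This gives `adaGrad_potential_step_le`;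
taking expectations (`integral_potential_step`) and telescoping bounds `∑ E[w ‖∇g‖²]` uniformly in
`T`, with `w = g / (√S √(S + e²))`.

Since `‖∇g‖² ≤ 4M g`, the weighted sum controls `‖∇g‖⁴ / (√S √(S + e²))`, and Young's inequality
with parameter `l` turns this into `E‖∇g‖² ≤ 4M l E[w‖∇g‖²] + E[S + e²] / l`. With `l` proportional
to `T`, the sum of gradients is `O(T)` plus a small multiple of `E[S_T]`. As `E[S_T] ≤ S₀ + σ₀ ∑
E‖∇g‖² + σ₁ T`, the inequality closes (`le_linear_of_self_bounding`). -/

/-! ### Smooth non-negative functions. -/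

theorem SmoothObjective.abs_sub_inner_le {d : ℕ} {g : EuclideanSpace ℝ (Fin d) → ℝ} {L : ℝ≥0}
    (h : SmoothObjective g L) (x y : EuclideanSpace ℝ (Fin d)) :
    |g y - g x - inner ℝ (gradient g x) (y - x)| ≤ L * ‖y - x‖ ^ 2 := by
  have hd : Differentiable ℝ g := h.contDiff.differentiable (by norm_num)
  -- The mean value inequality on the segment yields `L` where integration would yield `L / 2`; only
  -- constants are affected.
  have key := Convex.norm_image_sub_le_of_norm_fderiv_le' (𝕜 := ℝ) (f := g)
    (φ := fderiv ℝ g x) (C := L * ‖y - x‖) (s := segment ℝ x y) (x := x) (y := y)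
    (fun z _ => hd z) ?_ (convex_segment x y) (left_mem_segment ℝ x y) (right_mem_segment ℝ x y)
  · rw [inner_gradient_left, ← Real.norm_eq_abs]
    calc _ ≤ _ := key
      _ = _ := by ring
  · intro z hz
    rw [← toDual_gradient, ← toDual_gradient, ← map_sub, LinearIsometryEquiv.norm_map]
    have h1 := h.lipschitz.dist_le_mul z x
    rw [dist_eq_norm, dist_eq_norm] at h1
    refine h1.trans (mul_le_mul_of_nonneg_left ?_ L.2)
    obtain ⟨t, ht, rfl⟩ := (segment_eq_image' ℝ x y ▸ hz : z ∈ (fun θ : ℝ => x + θ • (y - x)) '' _)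
    simp only [add_sub_cancel_left, norm_smul, Real.norm_eq_abs, abs_of_nonneg ht.1]
    exact mul_le_of_le_one_left (norm_nonneg _) ht.2

/-- A gradient step of length `1 / (2M)` lowers `g` by at least `‖∇g‖² / (4M)`, and `g` cannot
become negative. The separate `M` allows `L = 0`. -/
theorem SmoothObjective.norm_gradient_sq_le {d : ℕ} {g : EuclideanSpace ℝ (Fin d) → ℝ} {L : ℝ≥0}
    (h : SmoothObjective g L) {M : ℝ} (hM : 0 < M) (hLM : L ≤ M)
    (x : EuclideanSpace ℝ (Fin d)) :
    ‖gradient g x‖ ^ 2 ≤ 4 * M * g x := by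
  set v := gradient g x with hv
  have h1 := h.abs_sub_inner_le x (x - (1 / (2 * M)) • v)
  have h2 := h.nonneg (x - (1 / (2 * M)) • v)
  have e1 : x - (1 / (2 * M)) • v - x = -((1 / (2 * M)) • v) := by abel
  rw [e1, inner_neg_right, inner_smul_right, ← hv, real_inner_self_eq_norm_sq, norm_neg,
    norm_smul, Real.norm_eq_abs, abs_of_pos (by positivity : 0 < 1 / (2 * M))] at h1
  have h3 := (abs_le.1 h1).2
  have h4 : (L : ℝ) * (1 / (2 * M) * ‖v‖) ^ 2 ≤ M * (1 / (2 * M) * ‖v‖) ^ 2 :=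
    mul_le_mul_of_nonneg_right hLM (sq_nonneg _)
  have h5 : M * (1 / (2 * M) * ‖v‖) ^ 2 = ‖v‖ ^ 2 / (4 * M) := by field_simp; ring
  have h6 : 1 / (2 * M) * ‖v‖ ^ 2 = 2 * (‖v‖ ^ 2 / (4 * M)) := by field_simp; ring
  have h7 : ‖v‖ ^ 2 / (4 * M) ≤ g x := by linarith
  rw [div_le_iff₀ (by positivity)] at h7
  linarith

/-! ### Deterministic one-step drift of the potential. -/

/-- The constant absorbing the lower-order terms of the drift of `g² / √S`. -/
noncomputable def adaGradDriftConst (M α σ₀ b : ℝ) : ℝ :=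
  16 * (10 * M * α ^ 2 + 1024 * α ^ 2 * M * σ₀) ^ 2 + 256 * α ^ 2 * b + 5 * M ^ 2 * α ^ 4

theorem adaGradDriftConst_nonneg (M α σ₀ : ℝ) {b : ℝ} (hb : 0 ≤ b) :
    0 ≤ adaGradDriftConst M α σ₀ b := by
  unfold adaGradDriftConst; positivity

/-- Replacing the random step size `1 / s'` by the predictable one `1 / t`. -/
theorem neg_div_le_of_sqrt_compare {s' t s u e r p : ℝ} (hs : 0 < s) (hs' : 0 < s') (ht : 0 < t)
    (hu : 0 ≤ u) (he : 0 < e) (hr : 0 ≤ r) (hs'sq : s' ^ 2 = s ^ 2 + u ^ 2)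
    (htsq : t ^ 2 = s ^ 2 + e ^ 2) (hp : |p| ≤ r * u) :
    -(2 * (p / s')) ≤ -(2 * (p / t)) + r ^ 2 * (u ^ 2 + e ^ 2) / (4 * e ^ 2 * t)
      + 4 * e * (u / s') ^ 2 := by
  -- Here `s'² - t² = u² - e²`, with `u ≤ s'` and `e ≤ t`.
  have hdiff : |1 / t - 1 / s'| ≤ |u - e| / (s' * t) := by
    have e1 : 1 / t - 1 / s' = (s' - t) / (s' * t) := by field_simp
    rw [e1, abs_div, abs_of_pos (mul_pos hs' ht)]
    refine div_le_div_of_nonneg_right ?_ (mul_pos hs' ht).le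
    have h1 : (s' - t) * (s' + t) = (u - e) * (u + e) := by nlinarith
    have h2 : |s' - t| * (s' + t) = |u - e| * (u + e) := by
      rw [← abs_of_pos (add_pos hs' ht), ← abs_mul, h1, abs_mul,
        abs_of_nonneg (add_nonneg hu he.le)]
    have hus : u ≤ s' := by nlinarith
    have het : e ≤ t := by nlinarith
    have h3 : |u - e| * (u + e) ≤ |u - e| * (s' + t) :=
      mul_le_mul_of_nonneg_left (by linarith) (abs_nonneg _)
    exact le_of_mul_le_mul_right (h2.trans_le h3) (add_pos hs' ht)
  have het : e ≤ t := by nlinarith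
  have h1 : 2 * (p / t) - 2 * (p / s') ≤ 2 * (r * u * (|u - e| / (s' * t))) := by
    have : 2 * (p / t) - 2 * (p / s') = 2 * (p * (1 / t - 1 / s')) := by ring
    rw [this]
    refine mul_le_mul_of_nonneg_left ((le_abs_self _).trans ?_) zero_le_two
    rw [abs_mul]
    exact mul_le_mul hp hdiff (abs_nonneg _) (mul_nonneg hr hu)
  have h2 : 2 * (r * u * (|u - e| / (s' * t)))
      ≤ (r ^ 2 * (u - e) ^ 2 / (4 * e ^ 2) + 4 * e ^ 2 * (u / s') ^ 2) / t := by
    -- The weight `2e` is chosen so that, once the conditional mean of `u²` is at most `e²`, the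
    -- first square costs at most `r² / (2t)`, a quarter of the descent term.
    have h := two_mul_le_add_sq (r * |u - e| / (2 * e)) (2 * e * (u / s'))
    have e1 : 2 * (r * u * (|u - e| / (s' * t)))
        = 2 * (r * |u - e| / (2 * e)) * (2 * e * (u / s')) / t := by field_simp
    have e2 : (r * |u - e| / (2 * e)) ^ 2 = r ^ 2 * (u - e) ^ 2 / (4 * e ^ 2) := by
      rw [div_pow, mul_pow, sq_abs]; ring
    have e3 : (2 * e * (u / s')) ^ 2 = 4 * e ^ 2 * (u / s') ^ 2 := by ring
    rw [e1]
    rw [e2, e3] at h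
    exact div_le_div_of_nonneg_right h ht.le
  have h3 : r ^ 2 * (u - e) ^ 2 / (4 * e ^ 2) ≤ r ^ 2 * (u ^ 2 + e ^ 2) / (4 * e ^ 2) := by
    refine div_le_div_of_nonneg_right ?_ (by positivity)
    exact mul_le_mul_of_nonneg_left (by nlinarith) (sq_nonneg r)
  have h4 : 4 * e ^ 2 * (u / s') ^ 2 / t ≤ 4 * e * (u / s') ^ 2 := by
    rw [div_le_iff₀ ht]
    have : 0 ≤ 4 * e * (u / s') ^ 2 := by positivity
    nlinarith
  have h5 : r ^ 2 * (u ^ 2 + e ^ 2) / (4 * e ^ 2) / t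
      = r ^ 2 * (u ^ 2 + e ^ 2) / (4 * e ^ 2 * t) := by rw [div_div]
  have h6 : r ^ 2 * (u - e) ^ 2 / (4 * e ^ 2) / t ≤ r ^ 2 * (u ^ 2 + e ^ 2) / (4 * e ^ 2) / t :=
    div_le_div_of_nonneg_right h3 ht.le
  rw [add_div] at h2
  linarith

theorem adaGrad_sq_le_of_step {M α r τ q γ γ' : ℝ} (hM : 0 < M) (hγ' : 0 ≤ γ')
    (hτsq : τ ^ 2 ≤ 1) (hq : q ^ 2 ≤ r ^ 2 * τ ^ 2) (hrγ : r ^ 2 ≤ 4 * M * γ)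
    (hup : γ' ≤ γ + (-(α * q) + M * (α ^ 2 * τ ^ 2))) :
    γ' ^ 2 ≤ γ ^ 2 + α * γ * (-(2 * q)) + 10 * M * α ^ 2 * γ * τ ^ 2
      + 2 * M ^ 2 * α ^ 4 * τ ^ 2 := by
  have h1 : γ' ^ 2 ≤ (γ + (-(α * q) + M * (α ^ 2 * τ ^ 2))) ^ 2 := pow_le_pow_left₀ hγ' hup 2
  have h2 : (-(α * q) + M * (α ^ 2 * τ ^ 2)) ^ 2
      ≤ 2 * (α ^ 2 * q ^ 2) + 2 * (M ^ 2 * α ^ 4 * (τ ^ 2 * τ ^ 2)) := by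
    linarith [sq_nonneg (α * q + M * (α ^ 2 * τ ^ 2))]
  have h3 : α ^ 2 * q ^ 2 ≤ α ^ 2 * (4 * M * γ * τ ^ 2) := by
    refine mul_le_mul_of_nonneg_left (hq.trans ?_) (sq_nonneg _)
    exact mul_le_mul_of_nonneg_right hrγ (sq_nonneg _)
  have h4 : M ^ 2 * α ^ 4 * (τ ^ 2 * τ ^ 2) ≤ M ^ 2 * α ^ 4 * τ ^ 2 := by
    refine mul_le_mul_of_nonneg_left ?_ (by positivity)
    exact mul_le_of_le_one_left (sq_nonneg _) hτsq
  linarith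

/-- Everything on the left is of order at most `γ^(3/2)`, since `e² = O(γ + 1)`, so Young's
inequality places it below a small multiple of `γ²` plus a constant. The bound must be in terms of
the new value `γ'`, because that is what the gain from the denominator multiplies. -/
theorem adaGrad_drift_coefficient_le {M α σ₀ b r e γ γ' : ℝ} (hM : 0 < M) (hα : 0 < α)
    (hσ₀ : 0 ≤ σ₀) (hγ : 0 ≤ γ) (hrγ : r ^ 2 ≤ 4 * M * γ)
    (hesq : e ^ 2 = σ₀ * r ^ 2 + b) (hγγ' : γ ≤ 2 * γ' + 6 * M * α ^ 2) :
    10 * M * α ^ 2 * γ + 2 * M ^ 2 * α ^ 4 + 4 * α * γ * e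
      ≤ γ' ^ 2 / 2 + adaGradDriftConst M α σ₀ b := by
  have hγsq : γ ^ 2 ≤ 8 * γ' ^ 2 + 72 * M ^ 2 * α ^ 4 := by
    have h1 : γ ^ 2 ≤ (2 * γ' + 6 * M * α ^ 2) ^ 2 := pow_le_pow_left₀ hγ hγγ' 2
    linarith [sq_nonneg (2 * γ' - 6 * M * α ^ 2)]
  have h1 : 4 * α * γ * e ≤ γ ^ 2 / 64 + 256 * α ^ 2 * e ^ 2 := by
    linarith [sq_nonneg (γ / 8 - 16 * α * e)]
  have h2 : e ^ 2 ≤ 4 * M * σ₀ * γ + b := by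
    rw [hesq]; linarith [mul_le_mul_of_nonneg_left hrγ hσ₀]
  have h3 : 256 * α ^ 2 * e ^ 2 ≤ 256 * α ^ 2 * (4 * M * σ₀ * γ + b) :=
    mul_le_mul_of_nonneg_left h2 (by positivity)
  have h4 : (10 * M * α ^ 2 + 1024 * α ^ 2 * M * σ₀) * γ
      ≤ γ ^ 2 / 64 + 16 * (10 * M * α ^ 2 + 1024 * α ^ 2 * M * σ₀) ^ 2 := by
    have h := sq_nonneg (γ / 8 - 4 * (10 * M * α ^ 2 + 1024 * α ^ 2 * M * σ₀))
    generalize 10 * M * α ^ 2 + 1024 * α ^ 2 * M * σ₀ = A at h ⊢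
    linarith
  have h5 : 0 ≤ M ^ 2 * α ^ 4 := by positivity
  rw [adaGradDriftConst]
  generalize 16 * (10 * M * α ^ 2 + 1024 * α ^ 2 * M * σ₀) ^ 2 = A at h4 ⊢
  linarith [sq_nonneg γ']

/-- The step has length at most `α` and the gradient is `O(√γ)`, so `γ` can drop by at most `γ / 2`
plus a constant. -/
theorem adaGrad_le_two_mul_of_step {M α r τ q γ γ' : ℝ} (hM : 0 < M) (hα : 0 ≤ α) (hr : 0 ≤ r)
    (hτ1 : τ ≤ 1) (hτsq : τ ^ 2 ≤ 1) (hq : |q| ≤ r * τ) (hrγ : r ^ 2 ≤ 4 * M * γ)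
    (hlow : γ - α * q - M * (α ^ 2 * τ ^ 2) ≤ γ') :
    γ ≤ 2 * γ' + 6 * M * α ^ 2 := by
  have h1 : α * q ≤ α * r := by
    refine mul_le_mul_of_nonneg_left ((le_abs_self q).trans (hq.trans ?_)) hα
    exact mul_le_of_le_one_right hr hτ1
  have h2 : α * r ≤ γ / 2 + 2 * M * α ^ 2 := by
    have h : 8 * M * (α * r) ≤ r ^ 2 + 16 * M ^ 2 * α ^ 2 := by
      linarith [sq_nonneg (r - 4 * M * α)]
    have h' : 8 * M * (α * r) ≤ 8 * M * (γ / 2 + 2 * M * α ^ 2) := by linarith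
    exact le_of_mul_le_mul_left h' (by positivity)
  have h3 : M * (α ^ 2 * τ ^ 2) ≤ M * α ^ 2 :=
    mul_le_mul_of_nonneg_left (mul_le_of_le_one_right (sq_nonneg _) hτsq) hM.le
  linarith

/-- The pathwise drift inequality for the potential `(g² + 2K) / √S`. -/
theorem adaGrad_potential_step_le {M α σ₀ b s s' t u e r p γ γ' : ℝ} (hM : 0 < M) (hα : 0 < α)
    (hσ₀ : 0 ≤ σ₀) (hb : 0 ≤ b) (hs : 0 < s) (hs' : 0 < s') (ht : 0 < t)
    (hu : 0 ≤ u) (he : 0 < e) (hr : 0 ≤ r) (hγ : 0 ≤ γ) (hγ' : 0 ≤ γ')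
    (hs'sq : s' ^ 2 = s ^ 2 + u ^ 2) (htsq : t ^ 2 = s ^ 2 + e ^ 2)
    (hesq : e ^ 2 = σ₀ * r ^ 2 + b) (hp : |p| ≤ r * u) (hrγ : r ^ 2 ≤ 4 * M * γ)
    (hstep : |γ' - γ + α * (p / s')| ≤ M * (α ^ 2 * (u / s') ^ 2)) :
    (γ' ^ 2 + 2 * adaGradDriftConst M α σ₀ b) / s'
      ≤ (γ ^ 2 + 2 * adaGradDriftConst M α σ₀ b) / s
        + (-(2 * α * (γ / (s * t) * p))
          + α * (γ / (s * t) * r ^ 2 / (4 * e ^ 2) * (u ^ 2 + e ^ 2))) := by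
  set K := adaGradDriftConst M α σ₀ b with hK
  have hK0 : 0 ≤ K := adaGradDriftConst_nonneg M α σ₀ hb
  set τ := u / s' with hτ
  set q := p / s' with hq
  have hss' : s ≤ s' := by nlinarith
  have hus' : u ≤ s' := by nlinarith
  have hτ0 : 0 ≤ τ := div_nonneg hu hs'.le
  have hτ1 : τ ≤ 1 := (div_le_one hs').2 hus'
  have hτsq : τ ^ 2 ≤ 1 := by nlinarith
  have hqτ : |q| ≤ r * τ := by
    rw [hq, hτ, abs_div, abs_of_pos hs', ← mul_div_assoc]
    exact div_le_div_of_nonneg_right hp hs'.le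
  have hq2 : q ^ 2 ≤ r ^ 2 * τ ^ 2 := by
    rw [← sq_abs, ← mul_pow]
    exact pow_le_pow_left₀ (abs_nonneg _) hqτ 2
  obtain ⟨hlow, hup⟩ := abs_le.1 hstep
  have hsq := adaGrad_sq_le_of_step hM hγ' hτsq hq2 hrγ
    (by linarith : γ' ≤ γ + (-(α * q) + M * (α ^ 2 * τ ^ 2)))
  have hcmp : -(2 * q) ≤ -(2 * (p / t)) + r ^ 2 * (u ^ 2 + e ^ 2) / (4 * e ^ 2 * t)
      + 4 * e * τ ^ 2 :=
    neg_div_le_of_sqrt_compare hs hs' ht hu he hr hs'sq htsq hp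
  have hcmp' := mul_le_mul_of_nonneg_left hcmp (mul_nonneg hα.le hγ)
  have hγlow := adaGrad_le_two_mul_of_step hM hα.le hr hτ1 hτsq hqτ hrγ
    (by linarith : γ - α * q - M * (α ^ 2 * τ ^ 2) ≤ γ')
  have hcoef := adaGrad_drift_coefficient_le hM hα hσ₀ hγ hrγ hesq hγlow
  rw [← hK] at hcoef
  have hcoef' := mul_le_mul_of_nonneg_right hcoef (sq_nonneg τ)
  have hmain : γ' ^ 2 ≤ γ ^ 2 + α * γ * (-(2 * (p / t))
      + r ^ 2 * (u ^ 2 + e ^ 2) / (4 * e ^ 2 * t)) + (γ' ^ 2 / 2 + K) * τ ^ 2 := by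
    linarith
  -- The gain from the growing denominator. Multiplied by `γ'² + 2K`, it cancels the error `(γ'² / 2
  -- + K) τ² / s` exactly.
  have hgain : τ ^ 2 / (2 * s) ≤ 1 / s - 1 / s' := by
    have h1 : 1 / s - 1 / s' = (s' - s) * (2 * s') / (s' ^ 2 * (2 * s)) := by field_simp
    rw [h1, hτ, div_pow, div_div]
    refine div_le_div_of_nonneg_right ?_ (by positivity)
    have h2 : u ^ 2 = (s' - s) * (s' + s) := by linarith
    rw [h2]
    exact mul_le_mul_of_nonneg_left (by linarith) (by linarith)
  have hgain' := mul_le_mul_of_nonneg_left hgain (by positivity : 0 ≤ γ' ^ 2 + 2 * K)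
  have hdiv := div_le_div_of_nonneg_right hmain hs.le
  have e1 : (γ ^ 2 + α * γ * (-(2 * (p / t)) + r ^ 2 * (u ^ 2 + e ^ 2) / (4 * e ^ 2 * t))
      + (γ' ^ 2 / 2 + K) * τ ^ 2) / s
      = γ ^ 2 / s + (-(2 * α * (γ / (s * t) * p))
          + α * (γ / (s * t) * r ^ 2 / (4 * e ^ 2) * (u ^ 2 + e ^ 2)))
        + (γ' ^ 2 + 2 * K) * (τ ^ 2 / (2 * s)) := by
    field_simp
  rw [e1] at hdiv
  have e2 : (γ' ^ 2 + 2 * K) * (1 / s - 1 / s')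
      = γ' ^ 2 / s + 2 * K / s - (γ' ^ 2 + 2 * K) / s' := by ring
  rw [e2] at hgain'
  rw [add_div (γ ^ 2)]
  linarith

/-! ### The drift in expectation. -/

/-- The coefficients `w`, `V`, `e` are measurable for the conditioning σ-algebra, so they come out
of the conditional expectation, leaving only the mean and second moment of `X`. Their boundedness
supplies integrability. -/
theorem integral_potential_step {Ω : Type*} {m mΩ : MeasurableSpace Ω} {μ : Measure Ω}
    [IsProbabilityMeasure μ] (hm : m ≤ mΩ) {E : Type*} [NormedAddCommGroup E]
    [InnerProductSpace ℝ E] [CompleteSpace E] {V X : Ω → E} {w e Φ Φ' : Ω → ℝ} {α B : ℝ}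
    (hα : 0 ≤ α) (hV : StronglyMeasurable[m] V) (hw : StronglyMeasurable[m] w)
    (he : StronglyMeasurable[m] e) (hw0 : ∀ ω, 0 ≤ w ω) (hwB : ∀ ω, w ω ≤ B)
    (hVB : ∀ ω, ‖V ω‖ ≤ B) (he1 : ∀ ω, 1 ≤ e ω ^ 2) (hX : Integrable X μ)
    (hX2 : Integrable (fun ω => ‖X ω‖ ^ 2) μ) (hunb : μ[X | m] =ᵐ[μ] V)
    (hvar : μ[fun ω => ‖X ω‖ ^ 2 | m] ≤ᵐ[μ] fun ω => e ω ^ 2)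
    (hΦ : Integrable Φ μ) (hΦ' : Integrable Φ' μ)
    (hstep : ∀ ω, Φ' ω ≤ Φ ω + (-(2 * α * (w ω * inner ℝ (V ω) (X ω)))
      + α * (w ω * ‖V ω‖ ^ 2 / (4 * e ω ^ 2) * (‖X ω‖ ^ 2 + e ω ^ 2)))) :
    ∫ ω, Φ' ω ∂μ + α * ∫ ω, w ω * ‖V ω‖ ^ 2 ∂μ ≤ ∫ ω, Φ ω ∂μ := by
  have hB0 : 0 ≤ B := by
    obtain ⟨ω⟩ : Nonempty Ω := nonempty_of_isProbabilityMeasure μ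
    exact (norm_nonneg _).trans (hVB ω)
  have hwV : Integrable (fun ω => w ω * ‖V ω‖ ^ 2) μ := by
    refine Integrable.of_bound ((hw.mul (hV.norm.pow 2)).mono hm).aestronglyMeasurable (B * B ^ 2)
      (ae_of_all _ fun ω => ?_)
    rw [Real.norm_eq_abs, abs_of_nonneg (mul_nonneg (hw0 ω) (sq_nonneg _))]
    exact mul_le_mul (hwB ω) (pow_le_pow_left₀ (norm_nonneg _) (hVB ω) 2) (sq_nonneg _) hB0
  -- the linear term
  have hY : StronglyMeasurable[m] (fun ω => w ω • V ω) := hw.smul hV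
  have hYX : Integrable (fun ω => innerSL ℝ (w ω • V ω) (X ω)) μ := by
    refine Integrable.mono' (hX.norm.const_mul (B * B))
      ((hY.mono hm).aestronglyMeasurable.inner hX.aestronglyMeasurable) (ae_of_all _ fun ω => ?_)
    refine (norm_inner_le_norm _ _).trans (mul_le_mul_of_nonneg_right ?_ (norm_nonneg _))
    rw [norm_smul, Real.norm_eq_abs, abs_of_nonneg (hw0 ω)]
    exact mul_le_mul (hwB ω) (hVB ω) (norm_nonneg _) hB0
  have hlin : ∫ ω, w ω * inner ℝ (V ω) (X ω) ∂μ = ∫ ω, w ω * ‖V ω‖ ^ 2 ∂μ := by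
    have h1 := condExp_bilin_of_stronglyMeasurable_left (innerSL ℝ) hY hYX hX
    have h2 := integral_condExp (μ := μ) hm (f := fun ω => innerSL ℝ (w ω • V ω) (X ω))
    have e1 : (fun ω => w ω * inner ℝ (V ω) (X ω)) = fun ω => innerSL ℝ (w ω • V ω) (X ω) := by
      ext ω; simp
    rw [e1, ← h2]
    refine integral_congr_ae ?_
    filter_upwards [h1, hunb] with ω a b
    rw [a, b]
    change inner ℝ (w ω • V ω) (V ω) = _
    rw [real_inner_smul_left, real_inner_self_eq_norm_sq]
  have hlinI : Integrable (fun ω => w ω * inner ℝ (V ω) (X ω)) μ := by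
    refine hYX.congr (ae_of_all _ fun ω => ?_)
    simp
  -- the quadratic term
  set W : Ω → ℝ := fun ω => w ω * ‖V ω‖ ^ 2 / (4 * e ω ^ 2) with hW
  have hW0 : ∀ ω, 0 ≤ W ω := fun ω => by
    have := hw0 ω
    simp only [hW]; positivity
  have hWB : ∀ ω, W ω ≤ B * B ^ 2 := fun ω => by
    refine (div_le_self (mul_nonneg (hw0 ω) (sq_nonneg _)) (by linarith [he1 ω])).trans ?_
    exact mul_le_mul (hwB ω) (pow_le_pow_left₀ (norm_nonneg _) (hVB ω) 2) (sq_nonneg _) hB0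
  have hWm : StronglyMeasurable[m] W :=
    (hw.mul (hV.norm.pow 2)).div (stronglyMeasurable_const.mul (he.pow 2))
  have hWe : ∀ ω, W ω * e ω ^ 2 = w ω * ‖V ω‖ ^ 2 / 4 := fun ω => by
    have h0 : e ω ≠ 0 := fun h => by have := he1 ω; norm_num [h] at this
    simp only [hW]; field_simp
  have hWX : Integrable (fun ω => W ω * ‖X ω‖ ^ 2) μ := by
    refine Integrable.mono' (hX2.const_mul (B * B ^ 2))
      ((hWm.mono hm).aestronglyMeasurable.mul hX2.aestronglyMeasurable) (ae_of_all _ fun ω => ?_)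
    rw [Real.norm_eq_abs, abs_of_nonneg (mul_nonneg (hW0 ω) (sq_nonneg _))]
    exact mul_le_mul_of_nonneg_right (hWB ω) (sq_nonneg _)
  have hquad : ∫ ω, W ω * ‖X ω‖ ^ 2 ∂μ ≤ ∫ ω, w ω * ‖V ω‖ ^ 2 / 4 ∂μ := by
    have h1 := condExp_mul_of_stronglyMeasurable_left (μ := μ) hWm
      (g := fun ω => ‖X ω‖ ^ 2) hWX hX2
    have h2 := integral_condExp (μ := μ) hm (f := W * fun ω => ‖X ω‖ ^ 2)
    change ∫ ω, (W * fun ω => ‖X ω‖ ^ 2) ω ∂μ ≤ _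
    rw [← h2]
    refine integral_mono_ae integrable_condExp (hwV.div_const 4) ?_
    filter_upwards [h1, hvar] with ω a b
    rw [a, ← hWe]
    exact mul_le_mul_of_nonneg_left b (hW0 ω)
  have hWXe : Integrable (fun ω => W ω * (‖X ω‖ ^ 2 + e ω ^ 2)) μ := by
    refine (hWX.add (hwV.div_const 4)).congr (ae_of_all _ fun ω => ?_)
    simp only [Pi.add_apply]
    rw [mul_add, hWe]
  have hsum : ∫ ω, W ω * (‖X ω‖ ^ 2 + e ω ^ 2) ∂μ
      = ∫ ω, W ω * ‖X ω‖ ^ 2 ∂μ + ∫ ω, w ω * ‖V ω‖ ^ 2 / 4 ∂μ := by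
    rw [← integral_add hWX (hwV.div_const 4)]
    refine integral_congr_ae (ae_of_all _ fun ω => ?_)
    simp only [mul_add, hWe]
  have hmono := integral_mono (μ := μ) hΦ'
    (hΦ.add ((hlinI.const_mul (2 * α)).neg.add (hWXe.const_mul α))) hstep
  rw [integral_add' hΦ ((hlinI.const_mul (2 * α)).neg.add (hWXe.const_mul α)),
    integral_add' (hlinI.const_mul (2 * α)).neg (hWXe.const_mul α), integral_neg',
    integral_const_mul, integral_const_mul, hlin, hsum] at hmono
  rw [integral_div] at hmono hquad
  have hpos : 0 ≤ ∫ ω, w ω * ‖V ω‖ ^ 2 ∂μ :=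
    integral_nonneg fun ω => mul_nonneg (hw0 ω) (sq_nonneg _)
  -- The linear term contributes `-2α` and the quadratic one at most `α/4 + α/4`; only `-α` of the
  -- total is kept.
  have h1 := mul_le_mul_of_nonneg_left hquad hα
  have h2 := mul_nonneg hα hpos
  linarith

/-! ### The closing recursion. -/

/-- A self-bounding recursion forces linear growth. -/
theorem le_linear_of_self_bounding {x y a : ℕ → ℝ} {σ₀ σ₁ A M b : ℝ} (hσ₀ : 0 ≤ σ₀)
    (hσ₁ : 0 ≤ σ₁) (hM : 0 ≤ M) (hb : 0 ≤ b) (ha0 : 0 ≤ a 0) (hmono : Monotone a)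
    (hrec : ∀ k, a (k + 1) ≤ a k + (σ₀ * x k + σ₁)) (hx : ∀ k, 0 ≤ x k)
    (hy : ∀ T, ∑ k ∈ Finset.range T, y k ≤ A)
    (hxy : ∀ k, ∀ l : ℝ, 0 < l → x k ≤ 4 * M * l * y k + (a k + (σ₀ * x k + b)) / l)
    {T : ℕ} (hT : 1 ≤ T) :
    a T ≤ (2 * a 0 + 2 * σ₁ + 8 * M * (4 * σ₀ + 1) * A * σ₀ + b) * T := by
  have hT' : (1 : ℝ) ≤ T := by exact_mod_cast hT
  have hT0 : (0 : ℝ) < T := by linarith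
  -- Taking `l = κ T` below makes `σ₀ / κ ≤ 1/4`, so the terms in `a T` and `Sx` on the right can be
  -- absorbed on the left.
  set κ := 4 * σ₀ + 1 with hκ
  have hκ1 : 1 ≤ κ := by linarith
  have hκ0 : 0 < κ := by linarith
  set Sx := ∑ k ∈ Finset.range T, x k with hSx
  have hSx0 : 0 ≤ Sx := Finset.sum_nonneg fun k _ => hx k
  have h1 : ∀ n, a n ≤ a 0 + (σ₀ * ∑ k ∈ Finset.range n, x k + σ₁ * n) := by
    intro n
    induction n with
    | zero => simp
    | succ n ih =>
      rw [Finset.sum_range_succ]; push_cast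
      linarith [hrec n]
  have h2 : Sx ≤ 4 * M * (κ * T) * A + (T * a T + (σ₀ * Sx + T * b)) / (κ * T) := by
    have hl : 0 < κ * T := mul_pos hκ0 hT0
    have h3 : Sx ≤ ∑ k ∈ Finset.range T,
        (4 * M * (κ * T) * y k + (a T + (σ₀ * x k + b)) / (κ * T)) := by
      refine Finset.sum_le_sum fun k hk => (hxy k _ hl).trans ?_
      have := hmono (Finset.mem_range.1 hk).le
      gcongr
    rw [Finset.sum_add_distrib, ← Finset.mul_sum, ← Finset.sum_div, Finset.sum_add_distrib,
      Finset.sum_add_distrib, ← Finset.mul_sum] at h3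
    simp only [Finset.sum_const, Finset.card_range, nsmul_eq_mul] at h3
    have := mul_le_mul_of_nonneg_left (hy T) (by positivity : 0 ≤ 4 * M * (κ * T))
    linarith
  have haT : 0 ≤ a T := ha0.trans (hmono (Nat.zero_le T))
  have h4 : (T * a T + (σ₀ * Sx + T * b)) / (κ * T) ≤ (a T + b) / κ + σ₀ * Sx / κ := by
    have e1 : (T * a T + (σ₀ * Sx + T * b)) / (κ * T)
        = (a T + b) / κ + σ₀ * Sx / κ / T := by field_simp; ring
    rw [e1]
    have : σ₀ * Sx / κ / T ≤ σ₀ * Sx / κ := div_le_self (by positivity) hT'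
    linarith
  have hσκ : σ₀ / κ ≤ 1 / 4 := by rw [div_le_iff₀ hκ0]; linarith
  have h5 : σ₀ * Sx / κ ≤ 1 / 4 * Sx := by
    rw [mul_div_right_comm]; exact mul_le_mul_of_nonneg_right hσκ hSx0
  have h6 : σ₀ * ((a T + b) / κ) ≤ 1 / 4 * (a T + b) := by
    have : σ₀ * ((a T + b) / κ) = σ₀ / κ * (a T + b) := by ring
    rw [this]; exact mul_le_mul_of_nonneg_right hσκ (by linarith)
  have h7 := mul_le_mul_of_nonneg_left
    (by linarith : Sx * (3 / 4) ≤ 4 * M * (κ * T) * A + (a T + b) / κ) hσ₀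
  have h8 := h1 T
  rw [← hSx] at h8
  have h9 : a 0 ≤ a 0 * T := le_mul_of_one_le_right ha0 hT'
  have h10 : b ≤ b * T := le_mul_of_one_le_right hb hT'
  have h11 : 0 ≤ σ₁ * T := by positivity
  nlinarith

/-! ### Measurability and boundedness along the trajectory. -/

theorem noiseSigma_mono {Ω Ξ : Type*} [MeasurableSpace Ξ] (ξ : ℕ → Ω → Ξ) {m n : ℕ}
    (hmn : m ≤ n) : noiseSigma ξ m ≤ noiseSigma ξ n :=
  biSup_mono fun _ hk => Finset.Icc_subset_Icc_right hmn hk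

theorem noiseSigma_le {Ω Ξ : Type*} [MeasurableSpace Ω] [MeasurableSpace Ξ] {ξ : ℕ → Ω → Ξ}
    (hξ : ∀ n, Measurable (ξ n)) (n : ℕ) : noiseSigma ξ n ≤ ‹MeasurableSpace Ω› :=
  iSup₂_le fun k _ => (hξ k).comap_le

theorem measurable_noise_noiseSigma {Ω Ξ : Type*} [MeasurableSpace Ξ] (ξ : ℕ → Ω → Ξ) (n : ℕ) :
    Measurable[noiseSigma ξ (n + 1)] (ξ (n + 1)) := by
  rw [measurable_iff_comap_le]
  exact le_iSup₂_of_le (n + 1) (by simp) le_rfl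

section Trajectory

variable {d : ℕ} {Ω Ξ : Type*}
  {G : EuclideanSpace ℝ (Fin d) → Ξ → EuclideanSpace ℝ (Fin d)} {α₀ S₀ : ℝ}
  {θ₁ : EuclideanSpace ℝ (Fin d)}

/-- The state at index `n` is `(θ_{n+1}, S_n)`, so this says that `θ_{n+1}` is predictable. -/
theorem measurable_adaGradNormState [MeasurableSpace Ξ] (hG : Measurable (Function.uncurry G))
    (ξ : ℕ → Ω → Ξ) (n : ℕ) :
    Measurable[noiseSigma ξ n] fun ω => adaGradNormState G α₀ S₀ θ₁ (fun i => ξ i ω) n := by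
  induction n with
  | zero => exact @measurable_const _ _ _ (noiseSigma ξ 0) _
  | succ n ih =>
    let _ : MeasurableSpace Ω := noiseSigma ξ (n + 1)
    have hst : Measurable fun ω => adaGradNormState G α₀ S₀ θ₁ (fun i => ξ i ω) n :=
      ih.mono (noiseSigma_mono ξ n.le_succ) le_rfl
    have hξ : Measurable (ξ (n + 1)) := measurable_noise_noiseSigma ξ n
    have hX : Measurable fun ω =>
        G (adaGradNormState G α₀ S₀ θ₁ (fun i => ξ i ω) n).1 (ξ (n + 1) ω) :=
      hG.comp (hst.fst.prodMk hξ)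
    have hS := hst.snd.add (hX.norm.pow_const 2)
    exact (hst.fst.sub ((hS.sqrt.const_div α₀).smul hX)).prodMk hS

theorem adaGradNormAccum_mono (z : ℕ → Ξ) : Monotone (adaGradNormAccum G α₀ S₀ θ₁ z) :=
  monotone_nat_of_le_succ fun n => by
    rw [adaGradNormAccum_succ]; exact le_add_of_nonneg_right (sq_nonneg _)

theorem le_adaGradNormAccum (z : ℕ → Ξ) (n : ℕ) : S₀ ≤ adaGradNormAccum G α₀ S₀ θ₁ z n :=
  adaGradNormAccum_mono z n.zero_le

/-- The accumulator already contains the current squared gradient, so normalisation caps the step at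
`α₀`. Hence the iterate at each fixed time stays in a deterministic ball, the source of all
integrability of `g` and its gradient. -/
theorem norm_adaGradNormIterate_succ_sub_le (hα₀ : 0 ≤ α₀) (hS₀ : 0 < S₀) (z : ℕ → Ξ) (n : ℕ) :
    ‖adaGradNormIterate G α₀ S₀ θ₁ z (n + 2) - adaGradNormIterate G α₀ S₀ θ₁ z (n + 1)‖
      ≤ α₀ := by
  have hS : 0 < adaGradNormAccum G α₀ S₀ θ₁ z (n + 1) := hS₀.trans_le (le_adaGradNormAccum z _)
  have hle : ‖G (adaGradNormIterate G α₀ S₀ θ₁ z (n + 1)) (z (n + 1))‖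
      ≤ Real.sqrt (adaGradNormAccum G α₀ S₀ θ₁ z (n + 1)) := by
    refine Real.le_sqrt_of_sq_le ?_
    rw [adaGradNormAccum_succ]
    exact le_add_of_nonneg_left (hS₀.le.trans (le_adaGradNormAccum z _))
  rw [adaGradNormIterate_succ, sub_sub_cancel_left, norm_neg, norm_smul, Real.norm_eq_abs,
    abs_of_nonneg (by positivity), div_mul_eq_mul_div, div_le_iff₀ (Real.sqrt_pos.2 hS)]
  exact mul_le_mul_of_nonneg_left hle hα₀

theorem adaGradNormIterate_mem_closedBall (hα₀ : 0 ≤ α₀) (hS₀ : 0 < S₀) (z : ℕ → Ξ) (n : ℕ) :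
    adaGradNormIterate G α₀ S₀ θ₁ z (n + 1) ∈ Metric.closedBall θ₁ (α₀ * n) := by
  induction n with
  | zero => simp [adaGradNormIterate_one]
  | succ n ih =>
    rw [mem_closedBall_iff_norm] at ih ⊢
    have h1 := norm_adaGradNormIterate_succ_sub_le (G := G) (θ₁ := θ₁) hα₀ hS₀ z n
    have h2 := norm_sub_le_norm_sub_add_norm_sub (adaGradNormIterate G α₀ S₀ θ₁ z (n + 2))
      (adaGradNormIterate G α₀ S₀ θ₁ z (n + 1)) θ₁
    push_cast
    linarith

/-- Along the trajectory, a continuous function of the iterate is bounded at each time. -/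
theorem exists_bound_adaGradNormIterate {F : Type*} [SeminormedAddCommGroup F]
    {f : EuclideanSpace ℝ (Fin d) → F} (hf : Continuous f) (hα₀ : 0 ≤ α₀) (hS₀ : 0 < S₀) (k : ℕ) :
    ∃ B, ∀ z : ℕ → Ξ, ‖f (adaGradNormIterate G α₀ S₀ θ₁ z (k + 1))‖ ≤ B := by
  obtain ⟨B, hB⟩ := (isCompact_closedBall θ₁ (α₀ * k)).exists_bound_of_continuousOn hf.continuousOn
  exact ⟨B, fun z => hB _ (adaGradNormIterate_mem_closedBall hα₀ hS₀ z k)⟩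

end Trajectory

section Oracle

variable {d : ℕ} {Ω Ξ : Type*} [MeasurableSpace Ω] [MeasurableSpace Ξ] {μ : Measure Ω}
  {g : EuclideanSpace ℝ (Fin d) → ℝ} {L : ℝ≥0}
  {G : EuclideanSpace ℝ (Fin d) → Ξ → EuclideanSpace ℝ (Fin d)} {ξ : ℕ → Ω → Ξ}
  {α₀ S₀ σ₀ σ₁ : ℝ} {θ₁ : EuclideanSpace ℝ (Fin d)}

theorem AffineNoiseOracle.integrable_accum [IsFiniteMeasure μ]
    (ho : AffineNoiseOracle μ g G ξ α₀ S₀ θ₁ σ₀ σ₁) (n : ℕ) :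
    Integrable (fun ω => adaGradNormAccum G α₀ S₀ θ₁ (fun i => ξ i ω) n) μ := by
  induction n with
  | zero => exact integrable_const S₀
  | succ n ih => exact ih.add (ho.integrable_sq n)

theorem AffineNoiseOracle.measurable_state (ho : AffineNoiseOracle μ g G ξ α₀ S₀ θ₁ σ₀ σ₁)
    (n : ℕ) : Measurable fun ω => adaGradNormState G α₀ S₀ θ₁ (fun i => ξ i ω) n :=
  (measurable_adaGradNormState ho.measurable_oracle ξ n).mono
    (noiseSigma_le ho.measurable_noise n) le_rfl

theorem AffineNoiseOracle.integrable_gradient_oracle [IsFiniteMeasure μ]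
    (ho : AffineNoiseOracle μ g G ξ α₀ S₀ θ₁ σ₀ σ₁) (k : ℕ) :
    Integrable (fun ω =>
      G (adaGradNormIterate G α₀ S₀ θ₁ (fun i => ξ i ω) (k + 1)) (ξ (k + 1) ω)) μ := by
  have hm : Measurable fun ω =>
      G (adaGradNormIterate G α₀ S₀ θ₁ (fun i => ξ i ω) (k + 1)) (ξ (k + 1) ω) :=
    ho.measurable_oracle.comp ((ho.measurable_state k).fst.prodMk (ho.measurable_noise (k + 1)))
  exact ((memLp_two_iff_integrable_sq_norm hm.aestronglyMeasurable).2
    (ho.integrable_sq k)).integrable one_le_two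

theorem SmoothObjective.continuous_gradient (h : SmoothObjective g L) : Continuous (gradient g) :=
  h.lipschitz.continuous

end Oracle

/-! ### Weight and potential as functions of the state. -/

/-- The predictable weight `g(θ) / (√S · √(S + σ₀‖∇g(θ)‖² + σ₁ + 1))` of a state `(θ, S)`. -/
noncomputable def adaGradWeight {d : ℕ} (g : EuclideanSpace ℝ (Fin d) → ℝ) (σ₀ σ₁ : ℝ)
    (p : EuclideanSpace ℝ (Fin d) × ℝ) : ℝ :=
  g p.1 / (Real.sqrt p.2 * Real.sqrt (p.2 + (σ₀ * ‖gradient g p.1‖ ^ 2 + σ₁ + 1)))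

/-- The potential `(g(θ)² + 2K) / √S` of a state `(θ, S)`. -/
noncomputable def adaGradPotential {d : ℕ} (g : EuclideanSpace ℝ (Fin d) → ℝ) (K : ℝ)
    (p : EuclideanSpace ℝ (Fin d) × ℝ) : ℝ :=
  (g p.1 ^ 2 + 2 * K) / Real.sqrt p.2

section

variable {d : ℕ} {g : EuclideanSpace ℝ (Fin d) → ℝ} {L : ℝ≥0}

theorem SmoothObjective.measurable_adaGradWeight (h : SmoothObjective g L) (σ₀ σ₁ : ℝ) :
    Measurable (adaGradWeight g σ₀ σ₁) := by
  have h1 : Measurable g := h.contDiff.continuous.measurable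
  have h2 : Measurable (gradient g) := h.continuous_gradient.measurable
  unfold adaGradWeight
  fun_prop

theorem SmoothObjective.measurable_adaGradPotential (h : SmoothObjective g L) (K : ℝ) :
    Measurable (adaGradPotential g K) := by
  have h1 : Measurable g := h.contDiff.continuous.measurable
  unfold adaGradPotential
  fun_prop

theorem SmoothObjective.adaGradWeight_nonneg (h : SmoothObjective g L) (σ₀ σ₁ : ℝ)
    (p : EuclideanSpace ℝ (Fin d) × ℝ) : 0 ≤ adaGradWeight g σ₀ σ₁ p :=
  div_nonneg (h.nonneg _) (by positivity)

theorem SmoothObjective.adaGradWeight_le (h : SmoothObjective g L) {σ₀ σ₁ S₀ : ℝ} (hσ₀ : 0 ≤ σ₀)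
    (hσ₁ : 0 ≤ σ₁) (hS₀ : 0 < S₀) {p : EuclideanSpace ℝ (Fin d) × ℝ} (hp : S₀ ≤ p.2) :
    adaGradWeight g σ₀ σ₁ p ≤ g p.1 / Real.sqrt S₀ := by
  have h1 : Real.sqrt S₀ ≤ Real.sqrt p.2 := Real.sqrt_le_sqrt hp
  have h2 : 1 ≤ Real.sqrt (p.2 + (σ₀ * ‖gradient g p.1‖ ^ 2 + σ₁ + 1)) := by
    rw [Real.one_le_sqrt]
    have : 0 ≤ σ₀ * ‖gradient g p.1‖ ^ 2 := by positivity
    linarith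
  refine div_le_div_of_nonneg_left (h.nonneg _) (Real.sqrt_pos.2 hS₀) (h1.trans ?_)
  exact le_mul_of_one_le_right (Real.sqrt_nonneg _) h2

/-- Young's inequality trading the squared gradient for the weighted drift. -/
theorem SmoothObjective.norm_gradient_sq_le_weight (h : SmoothObjective g L) {σ₀ σ₁ M l : ℝ}
    (hσ₀ : 0 ≤ σ₀) (hσ₁ : 0 ≤ σ₁) (hM : 0 < M) (hLM : L ≤ M) (hl : 0 < l)
    {p : EuclideanSpace ℝ (Fin d) × ℝ} (hp : 0 < p.2) :
    ‖gradient g p.1‖ ^ 2 ≤ 4 * M * l * (adaGradWeight g σ₀ σ₁ p * ‖gradient g p.1‖ ^ 2)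
      + (p.2 + (σ₀ * ‖gradient g p.1‖ ^ 2 + (σ₁ + 1))) / l := by
  have hx := h.norm_gradient_sq_le hM hLM p.1
  have hγ := h.nonneg p.1
  unfold adaGradWeight
  set x := ‖gradient g p.1‖ ^ 2 with hxdef
  have hx0 : 0 ≤ x := sq_nonneg _
  set γ := g p.1
  have hE : 0 ≤ σ₀ * x + σ₁ + 1 := by positivity
  have hD : 0 < p.2 + (σ₀ * x + σ₁ + 1) := by positivity
  set s := Real.sqrt p.2
  set t := Real.sqrt (p.2 + (σ₀ * x + σ₁ + 1))
  have hs : 0 < s := Real.sqrt_pos.2 hp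
  have ht : 0 < t := Real.sqrt_pos.2 hD
  have hst : s * t ≤ p.2 + (σ₀ * x + (σ₁ + 1)) := by
    have h1 : s ≤ t := Real.sqrt_le_sqrt (by linarith)
    calc s * t ≤ t * t := mul_le_mul_of_nonneg_right h1 ht.le
      _ = _ := by rw [Real.mul_self_sqrt hD.le]; ring
  -- Young's inequality for `x = (x / √(st)) · √(st)`; the difference of the two sides is written as
  -- a manifestly non-negative fraction.
  have hy : x ≤ l * (x * x / (s * t)) + s * t / l := by
    have h0 : 0 < s * t := mul_pos hs ht
    have h1 : l * (x * x / (s * t)) + s * t / l - x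
        = ((l * x - s * t) ^ 2 + l * x * (s * t)) / (l * (s * t)) := by
      field_simp; ring
    have h2 : 0 ≤ ((l * x - s * t) ^ 2 + l * x * (s * t)) / (l * (s * t)) := by positivity
    linarith
  have h3 : x * x / (s * t) ≤ 4 * M * (γ / (s * t) * x) := by
    have e1 : 4 * M * (γ / (s * t) * x) = 4 * M * γ * x / (s * t) := by ring
    rw [e1]
    exact div_le_div_of_nonneg_right (mul_le_mul_of_nonneg_right hx hx0) (by positivity)
  have h4 := mul_le_mul_of_nonneg_left h3 hl.le
  have h5 := div_le_div_of_nonneg_right hst hl.le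
  linarith

/-- The pathwise drift inequality along the AdaGrad-Norm recursion. -/
theorem SmoothObjective.adaGradPotential_succ_le {Ξ : Type*}
    {G : EuclideanSpace ℝ (Fin d) → Ξ → EuclideanSpace ℝ (Fin d)} {α₀ S₀ σ₀ σ₁ M : ℝ}
    {θ₁ : EuclideanSpace ℝ (Fin d)} (h : SmoothObjective g L) (hM : 0 < M) (hLM : L ≤ M)
    (hσ₀ : 0 ≤ σ₀) (hσ₁ : 0 ≤ σ₁) (hα₀ : 0 < α₀) (hS₀ : 0 < S₀) (z : ℕ → Ξ)
    (k : ℕ) (V X : EuclideanSpace ℝ (Fin d)) (w : ℝ)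
    (hV : V = gradient g (adaGradNormState G α₀ S₀ θ₁ z k).1)
    (hX : X = G (adaGradNormState G α₀ S₀ θ₁ z k).1 (z (k + 1)))
    (hw : w = adaGradWeight g σ₀ σ₁ (adaGradNormState G α₀ S₀ θ₁ z k)) :
    adaGradPotential g (adaGradDriftConst M α₀ σ₀ (σ₁ + 1))
        (adaGradNormState G α₀ S₀ θ₁ z (k + 1))
      ≤ adaGradPotential g (adaGradDriftConst M α₀ σ₀ (σ₁ + 1))
          (adaGradNormState G α₀ S₀ θ₁ z k)
        + (-(2 * α₀ * (w * inner ℝ V X)) + α₀ * (w * ‖V‖ ^ 2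
          / (4 * Real.sqrt (σ₀ * ‖V‖ ^ 2 + σ₁ + 1) ^ 2)
            * (‖X‖ ^ 2 + Real.sqrt (σ₀ * ‖V‖ ^ 2 + σ₁ + 1) ^ 2))) := by
  have hS : 0 < (adaGradNormState G α₀ S₀ θ₁ z k).2 := hS₀.trans_le (le_adaGradNormAccum z k)
  have hstate : adaGradNormState G α₀ S₀ θ₁ z (k + 1)
      = ((adaGradNormState G α₀ S₀ θ₁ z k).1
          - (α₀ / Real.sqrt ((adaGradNormState G α₀ S₀ θ₁ z k).2 + ‖X‖ ^ 2)) • X,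
        (adaGradNormState G α₀ S₀ θ₁ z k).2 + ‖X‖ ^ 2) := by
    rw [hX]; rfl
  rw [hstate]
  generalize adaGradNormState G α₀ S₀ θ₁ z k = p at *
  have hE : 0 < σ₀ * ‖V‖ ^ 2 + σ₁ + 1 := by positivity
  have hsq' : Real.sqrt (p.2 + ‖X‖ ^ 2) ^ 2 = p.2 + ‖X‖ ^ 2 := Real.sq_sqrt (by positivity)
  have hs' : 0 < Real.sqrt (p.2 + ‖X‖ ^ 2) := Real.sqrt_pos.2 (by positivity)
  have hw' : w = g p.1
      / (Real.sqrt p.2 * Real.sqrt (p.2 + (σ₀ * ‖V‖ ^ 2 + σ₁ + 1))) := by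
    rw [hw, hV]; rfl
  rw [hw']
  refine adaGrad_potential_step_le (u := ‖X‖) (e := Real.sqrt (σ₀ * ‖V‖ ^ 2 + σ₁ + 1))
    (r := ‖V‖) (t := Real.sqrt (p.2 + (σ₀ * ‖V‖ ^ 2 + σ₁ + 1))) hM hα₀ hσ₀
    (by linarith) (Real.sqrt_pos.2 hS) hs' (Real.sqrt_pos.2 (by positivity)) (norm_nonneg _)
    (Real.sqrt_pos.2 hE) (norm_nonneg _) (h.nonneg _) (h.nonneg _) ?_ ?_ ?_
    (abs_real_inner_le_norm _ _) ?_ ?_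
  · rw [hsq', Real.sq_sqrt hS.le]
  · rw [Real.sq_sqrt hS.le, Real.sq_sqrt hE.le, Real.sq_sqrt (by positivity)]
  · rw [Real.sq_sqrt hE.le, add_assoc]
  · rw [hV]; exact h.norm_gradient_sq_le hM hLM _
  · have h1 := h.abs_sub_inner_le p.1 (p.1 - (α₀ / Real.sqrt (p.2 + ‖X‖ ^ 2)) • X)
    rw [sub_sub_cancel_left, inner_neg_right, real_inner_smul_right, ← hV, norm_neg, norm_smul,
      Real.norm_eq_abs, abs_of_nonneg (by positivity : 0 ≤ α₀ / Real.sqrt (p.2 + ‖X‖ ^ 2)),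
      sub_neg_eq_add] at h1
    have e1 : α₀ / Real.sqrt (p.2 + ‖X‖ ^ 2) * inner ℝ V X
        = α₀ * (inner ℝ V X / Real.sqrt (p.2 + ‖X‖ ^ 2)) := by ring
    have e2 : (α₀ / Real.sqrt (p.2 + ‖X‖ ^ 2) * ‖X‖) ^ 2
        = α₀ ^ 2 * (‖X‖ / Real.sqrt (p.2 + ‖X‖ ^ 2)) ^ 2 := by ring
    rw [e1, e2] at h1
    exact h1.trans (mul_le_mul_of_nonneg_right hLM (by positivity))

/-! ### Expectations along the trajectory. -/

variable {Ω Ξ : Type*} [MeasurableSpace Ω] [MeasurableSpace Ξ] {μ : Measure Ω}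
  [IsProbabilityMeasure μ]
  {G : EuclideanSpace ℝ (Fin d) → Ξ → EuclideanSpace ℝ (Fin d)} {ξ : ℕ → Ω → Ξ}
  {α₀ S₀ σ₀ σ₁ : ℝ} {θ₁ : EuclideanSpace ℝ (Fin d)}

theorem AffineNoiseOracle.integrable_potential (ho : AffineNoiseOracle μ g G ξ α₀ S₀ θ₁ σ₀ σ₁)
    (h : SmoothObjective g L) (hα₀ : 0 ≤ α₀) (hS₀ : 0 < S₀) {K : ℝ} (hK : 0 ≤ K) (k : ℕ) :
    Integrable (fun ω =>
      adaGradPotential g K (adaGradNormState G α₀ S₀ θ₁ (fun i => ξ i ω) k)) μ := by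
  obtain ⟨B, hB⟩ := exists_bound_adaGradNormIterate (G := G) (θ₁ := θ₁) h.contDiff.continuous
    hα₀ hS₀ k
  refine Integrable.of_bound ((h.measurable_adaGradPotential K).comp
    (ho.measurable_state k)).aestronglyMeasurable ((B ^ 2 + 2 * K) / Real.sqrt S₀)
    (ae_of_all _ fun ω => ?_)
  have h1 : Real.sqrt S₀ ≤ Real.sqrt (adaGradNormState G α₀ S₀ θ₁ (fun i => ξ i ω) k).2 :=
    Real.sqrt_le_sqrt (le_adaGradNormAccum _ k)
  have h2 : g (adaGradNormState G α₀ S₀ θ₁ (fun i => ξ i ω) k).1 ^ 2 ≤ B ^ 2 := by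
    rw [← sq_abs]
    exact pow_le_pow_left₀ (abs_nonneg _) (hB fun i => ξ i ω) 2
  rw [adaGradPotential, Real.norm_eq_abs, abs_of_nonneg (by positivity)]
  have h3 := Real.sqrt_pos.2 hS₀
  gcongr

theorem AffineNoiseOracle.integrable_gradient_sq
    (ho : AffineNoiseOracle μ g G ξ α₀ S₀ θ₁ σ₀ σ₁)
    (h : SmoothObjective g L) (hα₀ : 0 ≤ α₀) (hS₀ : 0 < S₀) (k : ℕ) :
    Integrable (fun ω =>
      ‖gradient g (adaGradNormState G α₀ S₀ θ₁ (fun i => ξ i ω) k).1‖ ^ 2) μ := by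
  obtain ⟨B, hB⟩ := exists_bound_adaGradNormIterate (G := G) (θ₁ := θ₁) h.continuous_gradient
    hα₀ hS₀ k
  refine Integrable.of_bound ((h.continuous_gradient.measurable.comp
    (ho.measurable_state k).fst).norm.pow_const 2).aestronglyMeasurable (B ^ 2)
    (ae_of_all _ fun ω => ?_)
  rw [Real.norm_eq_abs, abs_of_nonneg (sq_nonneg _)]
  exact pow_le_pow_left₀ (norm_nonneg _) (hB fun i => ξ i ω) 2

theorem AffineNoiseOracle.integrable_weight_mul_gradient_sq
    (ho : AffineNoiseOracle μ g G ξ α₀ S₀ θ₁ σ₀ σ₁) (h : SmoothObjective g L) (hσ₀ : 0 ≤ σ₀)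
    (hσ₁ : 0 ≤ σ₁) (hα₀ : 0 ≤ α₀) (hS₀ : 0 < S₀) (k : ℕ) :
    Integrable (fun ω =>
      adaGradWeight g σ₀ σ₁ (adaGradNormState G α₀ S₀ θ₁ (fun i => ξ i ω) k)
        * ‖gradient g (adaGradNormState G α₀ S₀ θ₁ (fun i => ξ i ω) k).1‖ ^ 2) μ := by
  obtain ⟨B, hB⟩ := exists_bound_adaGradNormIterate (G := G) (θ₁ := θ₁) h.contDiff.continuous
    hα₀ hS₀ k
  refine (ho.integrable_gradient_sq h hα₀ hS₀ k).bdd_mul (c := B / Real.sqrt S₀)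
    ((h.measurable_adaGradWeight σ₀ σ₁).comp (ho.measurable_state k)).aestronglyMeasurable
    (ae_of_all _ fun ω => ?_)
  rw [Real.norm_eq_abs, abs_of_nonneg (h.adaGradWeight_nonneg _ _ _)]
  refine (h.adaGradWeight_le hσ₀ hσ₁ hS₀ (le_adaGradNormAccum _ k)).trans ?_
  exact div_le_div_of_nonneg_right ((le_abs_self _).trans (hB fun i => ξ i ω))
    (Real.sqrt_nonneg _)

theorem AffineNoiseOracle.integral_potential_succ_le
    (ho : AffineNoiseOracle μ g G ξ α₀ S₀ θ₁ σ₀ σ₁) (h : SmoothObjective g L) {M : ℝ} (hM : 0 < M)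
    (hLM : L ≤ M) (hσ₀ : 0 ≤ σ₀) (hσ₁ : 0 ≤ σ₁) (hα₀ : 0 < α₀) (hS₀ : 0 < S₀) (k : ℕ) :
    ∫ ω, adaGradPotential g (adaGradDriftConst M α₀ σ₀ (σ₁ + 1))
        (adaGradNormState G α₀ S₀ θ₁ (fun i => ξ i ω) (k + 1)) ∂μ
      + α₀ * ∫ ω, adaGradWeight g σ₀ σ₁ (adaGradNormState G α₀ S₀ θ₁ (fun i => ξ i ω) k)
        * ‖gradient g (adaGradNormState G α₀ S₀ θ₁ (fun i => ξ i ω) k).1‖ ^ 2 ∂μ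
      ≤ ∫ ω, adaGradPotential g (adaGradDriftConst M α₀ σ₀ (σ₁ + 1))
        (adaGradNormState G α₀ S₀ θ₁ (fun i => ξ i ω) k) ∂μ := by
  obtain ⟨B₁, hB₁⟩ := exists_bound_adaGradNormIterate (G := G) (θ₁ := θ₁) h.contDiff.continuous
    hα₀.le hS₀ k
  obtain ⟨B₂, hB₂⟩ := exists_bound_adaGradNormIterate (G := G) (θ₁ := θ₁) h.continuous_gradient
    hα₀.le hS₀ k
  have hm := noiseSigma_le ho.measurable_noise k
  have hst := measurable_adaGradNormState (α₀ := α₀) (S₀ := S₀) (θ₁ := θ₁)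
    ho.measurable_oracle ξ k
  have hV : StronglyMeasurable[noiseSigma ξ k] fun ω =>
      gradient g (adaGradNormState G α₀ S₀ θ₁ (fun i => ξ i ω) k).1 :=
    (h.continuous_gradient.measurable.comp (measurable_fst.comp hst)).stronglyMeasurable
  have hK := adaGradDriftConst_nonneg M α₀ σ₀ (by linarith : 0 ≤ σ₁ + 1)
  have hE : ∀ ω, Real.sqrt (σ₀ * ‖gradient g
      (adaGradNormState G α₀ S₀ θ₁ (fun i => ξ i ω) k).1‖ ^ 2 + σ₁ + 1) ^ 2 = σ₀ * ‖gradient g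
      (adaGradNormState G α₀ S₀ θ₁ (fun i => ξ i ω) k).1‖ ^ 2 + σ₁ + 1 :=
    fun ω => Real.sq_sqrt (by positivity)
  refine integral_potential_step (m := noiseSigma ξ k) hm
    (V := fun ω => gradient g (adaGradNormState G α₀ S₀ θ₁ (fun i => ξ i ω) k).1)
    (X := fun ω => G (adaGradNormState G α₀ S₀ θ₁ (fun i => ξ i ω) k).1 (ξ (k + 1) ω))
    (e := fun ω => Real.sqrt (σ₀ * ‖gradient g
      (adaGradNormState G α₀ S₀ θ₁ (fun i => ξ i ω) k).1‖ ^ 2 + σ₁ + 1))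
    (B := max (B₁ / Real.sqrt S₀) B₂) hα₀.le hV
    ((h.measurable_adaGradWeight σ₀ σ₁).comp hst).stronglyMeasurable ?_
    (fun ω => h.adaGradWeight_nonneg _ _ _) (fun ω => ?_)
    (fun ω => (hB₂ fun i => ξ i ω).trans (le_max_right _ _)) (fun ω => ?_)
    (ho.integrable_gradient_oracle k) (ho.integrable_sq k) (ho.unbiased k) ?_
    (ho.integrable_potential h hα₀.le hS₀ hK k) (ho.integrable_potential h hα₀.le hS₀ hK (k + 1))
    (fun ω => h.adaGradPotential_succ_le hM hLM hσ₀ hσ₁ hα₀ hS₀ (fun i => ξ i ω) k _ _ _ rfl rfl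
      rfl)
  · exact (Real.continuous_sqrt.measurable.comp
      (by fun_prop : Measurable fun x : ℝ => σ₀ * x ^ 2 + σ₁ + 1)).comp hV.norm.measurable
      |>.stronglyMeasurable
  · refine ((h.adaGradWeight_le hσ₀ hσ₁ hS₀ (le_adaGradNormAccum _ k)).trans ?_).trans
      (le_max_left _ _)
    exact div_le_div_of_nonneg_right ((le_abs_self _).trans (hB₁ fun i => ξ i ω))
      (Real.sqrt_nonneg _)
  · rw [hE]
    have : 0 ≤ σ₀ * ‖gradient g
      (adaGradNormState G α₀ S₀ θ₁ (fun i => ξ i ω) k).1‖ ^ 2 := by positivity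
    linarith
  · filter_upwards [ho.affine_variance k] with ω hω
    rw [hE]
    refine hω.trans ?_
    change σ₀ * ‖gradient g (adaGradNormState G α₀ S₀ θ₁ (fun i => ξ i ω) k).1‖ ^ 2 + σ₁ ≤ _
    linarith

theorem AffineNoiseOracle.sum_integral_weight_le
    (ho : AffineNoiseOracle μ g G ξ α₀ S₀ θ₁ σ₀ σ₁) (h : SmoothObjective g L) {M : ℝ} (hM : 0 < M)
    (hLM : L ≤ M) (hσ₀ : 0 ≤ σ₀) (hσ₁ : 0 ≤ σ₁) (hα₀ : 0 < α₀) (hS₀ : 0 < S₀) (T : ℕ) :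
    ∑ k ∈ Finset.range T,
      ∫ ω, adaGradWeight g σ₀ σ₁ (adaGradNormState G α₀ S₀ θ₁ (fun i => ξ i ω) k)
        * ‖gradient g (adaGradNormState G α₀ S₀ θ₁ (fun i => ξ i ω) k).1‖ ^ 2 ∂μ
      ≤ (g θ₁ ^ 2 + 2 * adaGradDriftConst M α₀ σ₀ (σ₁ + 1)) / Real.sqrt S₀ / α₀ := by
  rw [le_div_iff₀' hα₀]
  have hK := adaGradDriftConst_nonneg M α₀ σ₀ (by linarith : 0 ≤ σ₁ + 1)
  -- The final potential is kept on the left so that the induction telescopes; it is dropped by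
  -- non-negativity.
  suffices H : ∫ ω, adaGradPotential g (adaGradDriftConst M α₀ σ₀ (σ₁ + 1))
        (adaGradNormState G α₀ S₀ θ₁ (fun i => ξ i ω) T) ∂μ + α₀ * ∑ k ∈ Finset.range T,
      ∫ ω, adaGradWeight g σ₀ σ₁ (adaGradNormState G α₀ S₀ θ₁ (fun i => ξ i ω) k)
        * ‖gradient g (adaGradNormState G α₀ S₀ θ₁ (fun i => ξ i ω) k).1‖ ^ 2 ∂μ
      ≤ (g θ₁ ^ 2 + 2 * adaGradDriftConst M α₀ σ₀ (σ₁ + 1)) / Real.sqrt S₀ by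
    have : 0 ≤ ∫ ω, adaGradPotential g (adaGradDriftConst M α₀ σ₀ (σ₁ + 1))
        (adaGradNormState G α₀ S₀ θ₁ (fun i => ξ i ω) T) ∂μ :=
      integral_nonneg fun ω => div_nonneg (by positivity) (Real.sqrt_nonneg _)
    linarith
  induction T with
  | zero => simp [adaGradNormState, adaGradPotential]
  | succ T ih =>
    rw [Finset.sum_range_succ, mul_add]
    linarith [ho.integral_potential_succ_le h hM hLM hσ₀ hσ₁ hα₀ hS₀ T]

theorem AffineNoiseOracle.integral_accum_le
    (ho : AffineNoiseOracle μ g G ξ α₀ S₀ θ₁ σ₀ σ₁) (h : SmoothObjective g L) {M : ℝ} (hM : 0 < M)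
    (hLM : L ≤ M) (hσ₀ : 0 ≤ σ₀) (hσ₁ : 0 ≤ σ₁) (hα₀ : 0 < α₀) (hS₀ : 0 < S₀) {T : ℕ}
    (hT : 1 ≤ T) :
    ∫ ω, adaGradNormAccum G α₀ S₀ θ₁ (fun i => ξ i ω) T ∂μ
      ≤ (2 * S₀ + 2 * σ₁ + 8 * M * (4 * σ₀ + 1)
        * ((g θ₁ ^ 2 + 2 * adaGradDriftConst M α₀ σ₀ (σ₁ + 1)) / Real.sqrt S₀ / α₀) * σ₀
        + (σ₁ + 1)) * T := by
  have hI := ho.integrable_accum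
  have hXI := ho.integrable_gradient_sq h hα₀.le hS₀
  have hYI := ho.integrable_weight_mul_gradient_sq h hσ₀ hσ₁ hα₀.le hS₀
  have ha0 : ∫ ω, adaGradNormAccum G α₀ S₀ θ₁ (fun i => ξ i ω) 0 ∂μ = S₀ := by
    simp [adaGradNormAccum_zero]
  have key := le_linear_of_self_bounding
    (x := fun k => ∫ ω, ‖gradient g (adaGradNormState G α₀ S₀ θ₁ (fun i => ξ i ω) k).1‖ ^ 2 ∂μ)
    (a := fun k => ∫ ω, adaGradNormAccum G α₀ S₀ θ₁ (fun i => ξ i ω) k ∂μ)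
    (b := σ₁ + 1) hσ₀ hσ₁ hM.le (by linarith) (by rw [ha0]; exact hS₀.le)
    (fun m n hmn => integral_mono (hI m) (hI n) fun ω => adaGradNormAccum_mono _ hmn) ?_
    (fun k => integral_nonneg fun ω => sq_nonneg _)
    (ho.sum_integral_weight_le h hM hLM hσ₀ hσ₁ hα₀ hS₀) ?_ hT
  · simpa only [ha0] using key
  · intro k
    have hm := noiseSigma_le ho.measurable_noise k
    have h1 : ∫ ω, ‖G (adaGradNormIterate G α₀ S₀ θ₁ (fun i => ξ i ω) (k + 1)) (ξ (k + 1) ω)‖ ^ 2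
        ∂μ ≤ ∫ ω, (σ₀ * ‖gradient g (adaGradNormState G α₀ S₀ θ₁ (fun i => ξ i ω) k).1‖ ^ 2
          + σ₁) ∂μ := by
      rw [← integral_condExp hm]
      exact integral_mono_ae integrable_condExp
        (((hXI k).const_mul σ₀).add (integrable_const σ₁)) (ho.affine_variance k)
    rw [integral_add ((hXI k).const_mul σ₀) (integrable_const σ₁), integral_const_mul] at h1
    simp only [adaGradNormAccum_succ]
    rw [integral_add (hI k) (ho.integrable_sq k)]
    simpa using h1
  · intro k l hl
    have hJ : Integrable (fun ω => σ₀ *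
        ‖gradient g (adaGradNormState G α₀ S₀ θ₁ (fun i => ξ i ω) k).1‖ ^ 2 + (σ₁ + 1)) μ :=
      ((hXI k).const_mul σ₀).add (integrable_const _)
    have h1 := integral_mono (μ := μ) (hXI k)
      (((hYI k).const_mul (4 * M * l)).add (((hI k).add hJ).div_const l))
      (fun ω => h.norm_gradient_sq_le_weight hσ₀ hσ₁ hM hLM hl
        (hS₀.trans_le (le_adaGradNormAccum (fun i => ξ i ω) k)))
    rw [integral_add' ((hYI k).const_mul (4 * M * l)) (((hI k).add hJ).div_const l),
      integral_const_mul, integral_div, integral_add' (hI k) hJ,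
      integral_add ((hXI k).const_mul σ₀) (integrable_const _), integral_const_mul] at h1
    simpa using h1

end

theorem lemma4p3 (L : ℝ≥0) (σ₀ σ₁ α₀ S₀ g₁ : ℝ)
    (hσ₀ : 0 ≤ σ₀) (hσ₁ : 0 ≤ σ₁) (hα₀ : 0 < α₀) (hS₀ : 0 < S₀) :
    ∃ C : ℝ, ∀ (d : ℕ) (g : EuclideanSpace ℝ (Fin d) → ℝ) (θ₁ : EuclideanSpace ℝ (Fin d))
      (Ω : Type*) [MeasurableSpace Ω] (μ : Measure Ω) [IsProbabilityMeasure μ]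
      (Ξ : Type*) [MeasurableSpace Ξ]
      (G : EuclideanSpace ℝ (Fin d) → Ξ → EuclideanSpace ℝ (Fin d)) (ξ : ℕ → Ω → Ξ),
      SmoothObjective g L →
      g θ₁ = g₁ →
      AffineNoiseOracle μ g G ξ α₀ S₀ θ₁ σ₀ σ₁ →
      ∀ T : ℕ, 1 ≤ T →
        Integrable (fun ω => adaGradNormAccum G α₀ S₀ θ₁ (fun i => ξ i ω) T) μ ∧
        ∫ ω, adaGradNormAccum G α₀ S₀ θ₁ (fun i => ξ i ω) T ∂μ ≤ C * T := by
  -- `M = L + 1` keeps the smoothness constant positive even when `L = 0`.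
  refine ⟨2 * S₀ + 2 * σ₁ + 8 * (L + 1) * (4 * σ₀ + 1)
    * ((g₁ ^ 2 + 2 * adaGradDriftConst (L + 1) α₀ σ₀ (σ₁ + 1)) / Real.sqrt S₀ / α₀) * σ₀
    + (σ₁ + 1), ?_⟩
  rintro d g θ₁ Ω _ μ _ Ξ _ G ξ h rfl ho T hT
  exact ⟨ho.integrable_accum T, ho.integral_accum_le h (by positivity : (0 : ℝ) < L + 1)
    (by linarith) hσ₀ hσ₁ hα₀ hS₀ hT⟩
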